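/- **Setting.** Let $\mathbb K$ be a field with a valuation $\mathrm{val}:\mathbb K\to\mathbb R\cup\{-\infty\}$, so that $\mathrm{val}(ab)=\mathrm{val}(a)+\mathrm{val}(b)$, $\mathrm{val}(a+b)\le\max(\mathrm{val}(a),\mathrm{val}(b))$, and $\mathrm{val}(a)=-\infty$ iff $a=0$. Let $F=\sum_{(i,j)\in\mathcal A}a_{ij}x^iy^j$ with $\mathcal A\subset\mathbb Z^2$ finite and all $a_{ij}\in\mathbb K^*$. Let $\mathrm{Val}(C)\subset\mathbb R^2$ be its tropical curve, the set of points where $\max_{(i,j)\in\mathcal A}(iX+jY+\mathrm{val}(a_{ij}))$ is attained at least twice. For a vertex or an edge $D$ of $\mathrm{Val}(C)$, the dual cell $d(D)$ is the convex hull of the exponents $(i,j)$ whose monomials are maximal at all points of $D$; it is a face or an edge, respectively, of the subdivision of the Newton polygon. A *long edge* is a connected union of finitely many edges of $\mathrm{Val}(C)$ lying on one line. **Edge setting.** Let $p\in(\mathbb K^*)^2$ be a point of multiplicity $m$ of the curve $F=0$ with $P=\mathrm{Val}(p)=(0,0)$, such that $P$ lies on a horizontal edge $E$ of $\mathrm{Val}(C)$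 and is not a vertex of $\mathrm{Val}(C)$. Let $\mathfrak E$ be the maximal long edge containing $E$, let $A_1,\dots,A_n$ be the vertices on $\mathfrak E$ from left to right, and let $E_i$ be the edge in $\mathfrak E$ with left end $A_i$; let $E_0$ be the edge of $\mathfrak E$ without left end, if there is one. Then $d(E_i)=\{x_i\}\times[y_i,y^i]$ is a vertical edge of the subdivision; put $m_i=y^i-y_i$ and $\mathrm{val}_i=\mathrm{val}(a_{x_iy_i})=\mathrm{val}(a_{x_iy^i})$, and let $E=E_l$. If $\mathfrak E$ has a left end, let $d(E_0)$ be the leftmost vertex $(x_0,y_0)$ of the face $d(A_1)$, regarded as a vertical edge of length $m_0=0$, with $\mathrm{val}_0=\mathrm{val}(a_{x_0y_0})$. If $\mathfrak E$ has a right end, define in the same way the last member of the chain as the rightmost vertex of the face dual to that end, of length $0$. All these (genuine or zero-length) vertical edges, ordered from left to right, are indexed by consecutive integers. Let $\widetilde{\mathcal A}\subset\mathbb R^3$ be the convex hull of $\{(i,j,s):(i,j)\in\mathcal A,\ s\le\mathrm{val}(a_{ij})\}$. Let $g(x)=\max\{z:(x,y,z)\in\widetilde{\mathcal A}\text{ for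 some }y\}$, defined on the projection of $\widetilde{\mathcal A}$ to the $x$-axis. Let $\hat g(x)$ be the length of the interval $\{t:g(t)\ge g(x)\}$ in this domain. **Statement.** 1. $m_i\ge m-\hat g(x_i)$ for every index $i$, including those of the zero-length edges. 2. If $q<l\le r$, the index $r+1$ occurs, and $\mathrm{val}_r>\mathrm{val}_q\ge\mathrm{val}_{r+1}$, then $m_q+(x_{r+1}-x_q)\ge m$. Symmetrically, if $r\le l<q$, the index $r-1$ occurs, and $\mathrm{val}_r>\mathrm{val}_q\ge\mathrm{val}_{r-1}$, then $m_q+(x_q-x_{r-1})\ge m$. -/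

import Mathlib

open scoped WithZero

noncomputable section

namespace TropMult

/-- Laurent polynomials `∑ a_{ij} x^i y^j` in two variables over `K`. The exponent set `𝒜` of such a
polynomial `F` is its support, so that all `a_{ij}` with `(i, j) ∈ 𝒜` are nonzero. -/
abbrev Laurent (K : Type*) [Field K] := AddMonoidAlgebra K (ℤ × ℤ)

/-- The ideal `⟨x - p₁, y - p₂⟩` of a point `p` of the torus `(K^*)²`. -/
def pointIdeal {K : Type*} [Field K] (p : Kˣ × Kˣ) : Ideal (Laurent K) :=
  Ideal.span {AddMonoidAlgebra.single ((1, 0) : ℤ × ℤ) (1 : K) -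
      AddMonoidAlgebra.single ((0, 0) : ℤ × ℤ) (p.1 : K),
    AddMonoidAlgebra.single ((0, 1) : ℤ × ℤ) (1 : K) -
      AddMonoidAlgebra.single ((0, 0) : ℤ × ℤ) (p.2 : K)}

/-- `p` is a point of multiplicity `m` of the curve `F = 0`: `m` is the largest exponent with
`F ∈ ⟨x - p₁, y - p₂⟩ ^ m`. (This ideal is maximal, so its powers are primary and membership in a
power may be tested before passing to the local ring of `p`.) -/
def HasMultiplicity {K : Type*} [Field K] (F : Laurent K) (p : Kˣ × Kˣ) (m : ℕ) : Prop :=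
  F ∈ pointIdeal p ^ m ∧ F ∉ pointIdeal p ^ (m + 1)

/-- The point `Val(p) = (val p₁, val p₂)`. The real-valued `val` of a nonzero element is the
logarithm of its multiplicatively written valuation, `val (a + b) ≤ max (val a) (val b)`. -/
def valPoint {K : Type*} [Field K] (v : Valuation K ℝᵐ⁰) (p : Kˣ × Kˣ) : ℝ × ℝ :=
  (WithZero.log (v (p.1 : K)), WithZero.log (v (p.2 : K)))

section Tropical

variable {K : Type*} [Field K] (v : Valuation K ℝᵐ⁰) (F : Laurent K)

/-- `val(a_{ij})`; used only for `(i, j)` in the support of `F`. -/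
def coeffVal (e : ℤ × ℤ) : ℝ := WithZero.log (v (F.coeff e))

/-- The lattice point `(i, j)` as a point of `ℝ²`. -/
def pt (e : ℤ × ℤ) : ℝ × ℝ := ((e.1 : ℝ), (e.2 : ℝ))

/-- The tropical monomial `iX + jY + val(a_{ij})`. -/
def tropTerm (e : ℤ × ℤ) (Q : ℝ × ℝ) : ℝ := e.1 * Q.1 + e.2 * Q.2 + coeffVal v F e

/-- The exponents in the support of `F` whose tropical monomials attain
`Val(F)(Q) = max_{(i,j)} (iX + jY + val(a_{ij}))` at `Q = (X, Y)`. -/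
def topSupport (Q : ℝ × ℝ) : Set (ℤ × ℤ) :=
  {e | e ∈ F.coeff.support ∧ ∀ e' ∈ F.coeff.support, tropTerm v F e' Q ≤ tropTerm v F e Q}

/-- The tropical curve: the points where the maximum is attained at least twice. -/
def tropCurve : Set (ℝ × ℝ) := {Q | (topSupport v F Q).Nontrivial}

/-- A vertex of the tropical curve: the dual cell is two-dimensional. -/
def IsVertex (Q : ℝ × ℝ) : Prop := ¬ Collinear ℝ (pt '' topSupport v F Q)

/-- A (closed) edge of the tropical curve: for some point `Q` of the curve which is not a vertex,
the set of points at which all the monomials that are maximal at `Q` are maximal. -/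
def IsEdge (E : Set (ℝ × ℝ)) : Prop :=
  ∃ Q ∈ tropCurve v F, ¬ IsVertex v F Q ∧ E = {Q' | topSupport v F Q ⊆ topSupport v F Q'}

/-- The cell of the subdivision of the Newton polygon dual to a cell `D` (an edge `E`, or a vertex
`A` as the set `{A}`): the convex hull of the exponents whose monomials are maximal on all of `D`. -/
def dualCell (D : Set (ℝ × ℝ)) : Set (ℝ × ℝ) :=
  convexHull ℝ (pt '' {e | ∀ Q ∈ D, e ∈ topSupport v F Q})

/-- A long edge: a connected union of finitely many edges arranged along a line. -/
def IsLongEdge (L : Set (ℝ × ℝ)) : Prop :=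
  ∃ 𝓔 : Set (Set (ℝ × ℝ)), 𝓔.Finite ∧ 𝓔.Nonempty ∧ (∀ E ∈ 𝓔, IsEdge v F E) ∧
    Collinear ℝ (⋃₀ 𝓔) ∧ IsConnected (⋃₀ 𝓔) ∧ L = ⋃₀ 𝓔

end Tropical

/-- A vertical segment `{x} × [lo, hi]` with integer endpoints, possibly a point. -/
structure VSeg where
  x : ℤ
  lo : ℤ
  hi : ℤ
  le : lo ≤ hi

/-- The set of real points of the segment. -/
def VSeg.carrier (S : VSeg) : Set (ℝ × ℝ) := segment ℝ (pt (S.x, S.lo)) (pt (S.x, S.hi))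

/-- The integer length of the segment. -/
def VSeg.length (S : VSeg) : ℤ := S.hi - S.lo

section Chain

variable {K : Type*} [Field K] (v : Valuation K ℝᵐ⁰) (F : Laurent K)

/-- `S` is the dual edge `d(E)` of an edge `E` contained in the (horizontal) long edge `L`. -/
def IsEdgeSeg (L : Set (ℝ × ℝ)) (S : VSeg) : Prop :=
  ∃ E, IsEdge v F E ∧ E ⊆ L ∧ dualCell v F E = S.carrier

/-- `L` has a left end `A`, and `S`, of length zero, is the leftmost vertex of the face `d(A)`. -/
def IsLeftEndSeg (L : Set (ℝ × ℝ)) (S : VSeg) : Prop :=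
  S.lo = S.hi ∧ ∃ A ∈ L, (∀ Q ∈ L, A.1 ≤ Q.1) ∧ pt (S.x, S.lo) ∈ dualCell v F {A} ∧
    ∀ w ∈ dualCell v F {A}, w ≠ pt (S.x, S.lo) → (S.x : ℝ) < w.1

/-- `L` has a right end `A`, and `S`, of length zero, is the rightmost vertex of the face `d(A)`. -/
def IsRightEndSeg (L : Set (ℝ × ℝ)) (S : VSeg) : Prop :=
  S.lo = S.hi ∧ ∃ A ∈ L, (∀ Q ∈ L, Q.1 ≤ A.1) ∧ pt (S.x, S.lo) ∈ dualCell v F {A} ∧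
    ∀ w ∈ dualCell v F {A}, w ≠ pt (S.x, S.lo) → w.1 < (S.x : ℝ)

/-- The segments `d(E_0), d(E_1), …` attached to the horizontal long edge `L`: the vertical edges
dual to the edges in `L`, and, at each end of `L` that exists, the extreme vertex of the face dual
to that end, as a vertical edge of length zero. -/
def chain (L : Set (ℝ × ℝ)) : Set VSeg :=
  {S | IsEdgeSeg v F L S ∨ IsLeftEndSeg v F L S ∨ IsRightEndSeg v F L S}

/-- `R` and `S` are consecutive in the chain, with `R` to the left of `S`. -/
def Consecutive (L : Set (ℝ × ℝ)) (R S : VSeg) : Prop :=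
  R ∈ chain v F L ∧ S ∈ chain v F L ∧ R.x < S.x ∧
    ∀ T ∈ chain v F L, ¬ (R.x < T.x ∧ T.x < S.x)

/-- The common valuation of the coefficients at the endpoints of a segment of the chain, i.e. the
height of its lifting to the extended Newton polyhedron. -/
def segVal (S : VSeg) : ℝ := coeffVal v F (S.x, S.lo)

/-- The extended Newton polyhedron: the convex hull of
`{(i, j, s) | (i, j) ∈ 𝒜, s ≤ val(a_{ij})}`. -/
def extNewton : Set (ℝ × ℝ × ℝ) :=
  convexHull ℝ {w | ∃ e ∈ F.coeff.support,
    w.1 = (e.1 : ℝ) ∧ w.2.1 = (e.2 : ℝ) ∧ w.2.2 ≤ coeffVal v F e}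

/-- The domain of `g`: the projection of the extended Newton polyhedron to the `x`-axis. -/
def gDomain : Set ℝ := {x | ∃ y z : ℝ, (x, y, z) ∈ extNewton v F}

/-- `g(x) = max {z | (x, y, z) ∈ extNewton}` for `x` in `gDomain`: the upper boundary of the
projection to the `xz`-plane. -/
def g (x : ℝ) : ℝ := sSup {z | ∃ y : ℝ, (x, y, z) ∈ extNewton v F}

/-- `ĝ(x)`: the length of the interval `{t | g t ≥ g x}`, i.e. of the chord which the graph of the
concave function `g` cuts out of the horizontal line at height `g x`. -/
def gHat (x : ℝ) : ℝ := MeasureTheory.volume.real {t | t ∈ gDomain v F ∧ g v F x ≤ g v F t}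

end Chain

end TropMult

end

/-! If `F` lies in the `m`-th power of the ideal of `p`, then `∑ P(e) a_e p^e = 0` for every integer
combination `P` of products `C(i - a, n) C(j - b, n')` with `n + n' < m`. Binomials replace
derivatives: their values are integers, of valuation at most 1, so the argument works in every
characteristic. Since `Val(p)` is the origin, the monomials `p^e` do not affect valuations. Fix `e₀`
and suppose the coefficients at least as large as `a_{e₀}` lie in columns `a, …, b`, and within the
column of `e₀` at heights `lo, …, hi`. Some `P` of degree `(b - a) + (hi - lo)` is 1 at `e₀` and 0
at all other such exponents. If this degree were below `m`, the vanishing sum would have one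
strictly dominant term. Hence `multiplicity_le_add`. For a member of the chain, take `e₀` to be its
lower end. Maximality at a point `(X, 0)` confines the large coefficients of that column to the
segment, so only their horizontal spread must be bounded: by a chord of `g` for the first claim
(`sub_le_gHat`), and by the concave profile of the valuations for the second (`le_fst_of_segVal_lt`,
`fst_le_of_segVal_lt`). -/

noncomputable section

namespace TropMult

/-! ### Integer-weighted evaluations and the basic multiplicity bound -/

section Functional

variable {K : Type*} [Field K]

/-- The value at the point `p` of the monomial with exponent `e`. -/
def monomialAt (p : Kˣ × Kˣ) (e : ℤ × ℤ) : K := (p.1 : K) ^ e.1 * (p.2 : K) ^ e.2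

lemma monomialAt_add (p : Kˣ × Kˣ) (e u : ℤ × ℤ) :
    monomialAt p (e + u) = monomialAt p e * monomialAt p u := by
  simp only [monomialAt, Prod.fst_add, Prod.snd_add, zpow_add₀ p.1.ne_zero, zpow_add₀ p.2.ne_zero]
  ring

/-- The functional `∑ a_e x^e ↦ ∑ P(e) a_e p^e` given by an integer weight `P` on exponents. -/
def weightedEval (p : Kˣ × Kˣ) (P : ℤ × ℤ → ℤ) : Laurent K →ₗ[K] K :=
  Finsupp.linearCombination K (fun e ↦ (P e : K) * monomialAt p e) ∘ₗ
    (AddMonoidAlgebra.coeffLinearEquiv K).toLinearMap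

lemma weightedEval_apply (p : Kˣ × Kˣ) (P : ℤ × ℤ → ℤ) (F : Laurent K) :
    weightedEval p P F = ∑ e ∈ F.coeff.support, F.coeff e * ((P e : K) * monomialAt p e) := by
  simp [weightedEval, Finsupp.linearCombination_apply, Finsupp.sum]

lemma weightedEval_single (p : Kˣ × Kˣ) (P : ℤ × ℤ → ℤ) (e : ℤ × ℤ) (c : K) :
    weightedEval p P (AddMonoidAlgebra.single e c) = c * ((P e : K) * monomialAt p e) := by
  simp [weightedEval, Finsupp.linearCombination_apply]

/-- Multiplication by `x^u - p^u` acts on weights as a forward difference. -/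
lemma weightedEval_sub_mul (p : Kˣ × Kˣ) (P : ℤ × ℤ → ℤ) (u : ℤ × ℤ) (G : Laurent K) :
    weightedEval p P ((AddMonoidAlgebra.single u (1 : K) -
      AddMonoidAlgebra.single ((0, 0) : ℤ × ℤ) (monomialAt p u)) * G) =
    monomialAt p u * weightedEval p (fun e ↦ P (e + u) - P e) G := by
  induction G using AddMonoidAlgebra.induction_linear with
  | zero => simp
  | add G H hG hH => rw [mul_add, map_add, hG, hH, map_add, mul_add]
  | single e c =>
    rw [sub_mul, AddMonoidAlgebra.single_mul_single, AddMonoidAlgebra.single_mul_single, map_sub]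
    simp only [weightedEval_single]
    rw [add_comm u e, monomialAt_add, show ((0, 0) : ℤ × ℤ) + e = e from zero_add e]
    push_cast
    ring

/-- The product of binomial coefficients `C(i - a, n) C(j - b, n')` as a weight. -/
def binomialWeight (a b : ℤ) (n n' : ℕ) (e : ℤ × ℤ) : ℤ :=
  Ring.choose (e.1 - a) n * Ring.choose (e.2 - b) n'

lemma weightedEval_zero_weight (p : Kˣ × Kˣ) (G : Laurent K) :
    weightedEval p (fun _ ↦ 0) G = 0 := by
  simp [weightedEval_apply]

/-- Each factor `x - p₁` or `y - p₂` turns the weight into its forward difference, which by Pascal's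
rule lowers one binomial index by one, or is zero if that index is already 0. With fewer than `m`
index steps available, `m` factors annihilate the weight. -/
lemma weightedEval_binomialWeight_eq_zero (p : Kˣ × Kˣ) (a b : ℤ) (m : ℕ) :
    ∀ (n n' : ℕ), n + n' < m → ∀ F ∈ pointIdeal p ^ m,
      weightedEval p (binomialWeight a b n n') F = 0 := by
  induction m with
  | zero => intro n n' h; omega
  | succ m ih =>
    intro n n' h F hF
    rw [pow_succ] at hF
    refine Submodule.mul_induction_on hF ?_ fun G H hG hH ↦ by rw [map_add, hG, hH, add_zero]
    intro G hG H hH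
    obtain ⟨u, w, rfl⟩ := Ideal.mem_span_pair.1 hH
    have h1 : monomialAt p (1, 0) = p.1 := by simp [monomialAt]
    have h2 : monomialAt p (0, 1) = p.2 := by simp [monomialAt]
    rw [← h1, ← h2, mul_add, map_add]
    have hu := Ideal.mul_mem_right u _ hG
    have hw := Ideal.mul_mem_right w _ hG
    rw [show ∀ x : Laurent K, G * (u * x) = x * (G * u) from fun x ↦ by ring,
      show ∀ x : Laurent K, G * (w * x) = x * (G * w) from fun x ↦ by ring,
      weightedEval_sub_mul, weightedEval_sub_mul]
    have hx : weightedEval p (fun e ↦ binomialWeight a b n n' (e + (1, 0)) -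
        binomialWeight a b n n' e) (G * u) = 0 := by
      cases n with
      | zero =>
        convert weightedEval_zero_weight p (G * u) using 3 with e
        simp [binomialWeight]
      | succ n =>
        convert ih n n' (by omega) _ hu using 2
        congr 1
        ext e
        simp only [binomialWeight, Prod.fst_add, Prod.snd_add, add_zero, add_sub_right_comm,
          Ring.choose_succ_succ]
        ring
    have hy : weightedEval p (fun e ↦ binomialWeight a b n n' (e + (0, 1)) -
        binomialWeight a b n n' e) (G * w) = 0 := by
      cases n' with
      | zero =>
        convert weightedEval_zero_weight p (G * w) using 3 with e
        simp [binomialWeight]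
      | succ n' =>
        convert ih n n' (by omega) _ hw using 2
        congr 1
        ext e
        simp only [binomialWeight, Prod.fst_add, Prod.snd_add, add_zero, add_sub_right_comm,
          Ring.choose_succ_succ]
        ring
    rw [hx, hy, mul_zero, mul_zero, add_zero]

/-- A function on an integer interval of length `k` is an integral combination of the first `k + 1`
binomial coefficients. -/
lemma exists_sum_choose_eq (f : ℤ → ℤ) (a b : ℤ) : ∃ c : ℕ → ℤ, ∀ t, a ≤ t → t ≤ b →
    ∑ n ∈ Finset.range ((b - a).toNat + 1), c n * Ring.choose (t - a) n = f t := by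
  -- Newton's forward difference formula at `a`; its terms beyond `n = t - a` vanish, so one range
  -- serves all `t`.
  refine ⟨fun n ↦ (fwdDiff 1)^[n] f a, fun t hat htb ↦ ?_⟩
  obtain ⟨i, hi⟩ := Int.eq_ofNat_of_zero_le (sub_nonneg.2 hat)
  have h := shift_eq_sum_fwdDiff_iter 1 f i a
  have ht : a + i • (1 : ℤ) = t := by simp; omega
  rw [ht] at h
  rw [h, hi]
  symm
  refine Finset.sum_subset_zero_on_sdiff (Finset.range_mono (by omega)) ?_ ?_
  · intro n hn
    simp only [Finset.mem_sdiff, Finset.mem_range] at hn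
    have : i.choose n = 0 := Nat.choose_eq_zero_of_lt (by omega)
    simp [Ring.choose_natCast, this]
  · intro n _
    simp [Ring.choose_natCast, mul_comm]

/-- The coefficients of valuation at least that of `a_{e₀}` lie in columns `a, …, b`, and those in
the column of `e₀` at heights `lo, …, hi`: then the multiplicity is at most the sum of the two
lengths. -/
lemma multiplicity_le_add (v : Valuation K ℝᵐ⁰) {F : Laurent K} {p : Kˣ × Kˣ} {m : ℕ}
    (hF : F ∈ pointIdeal p ^ m) (hp₁ : v (p.1 : K) = 1) (hp₂ : v (p.2 : K) = 1)
    {e₀ : ℤ × ℤ} (he₀ : e₀ ∈ F.coeff.support) {a b lo hi : ℤ}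
    (hcol : ∀ e ∈ F.coeff.support, v (F.coeff e₀) ≤ v (F.coeff e) → a ≤ e.1 ∧ e.1 ≤ b)
    (hrow : ∀ e ∈ F.coeff.support, v (F.coeff e₀) ≤ v (F.coeff e) → e.1 = e₀.1 →
      lo ≤ e.2 ∧ e.2 ≤ hi) :
    (m : ℤ) ≤ (b - a) + (hi - lo) := by
  by_contra! hm
  have hab := hcol e₀ he₀ le_rfl
  have hlh := hrow e₀ he₀ le_rfl rfl
  obtain ⟨c, hc⟩ := exists_sum_choose_eq (fun t ↦ if t = e₀.1 then 1 else 0) a b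
  obtain ⟨d, hd⟩ := exists_sum_choose_eq (fun t ↦ if t = e₀.2 then 1 else 0) lo hi
  set P : ℤ × ℤ → ℤ := fun e ↦
    (∑ n ∈ Finset.range ((b - a).toNat + 1), c n * Ring.choose (e.1 - a) n) *
      ∑ n ∈ Finset.range ((hi - lo).toNat + 1), d n * Ring.choose (e.2 - lo) n with hPdef
  have hP0 : weightedEval p P F = 0 := by
    have : weightedEval p P F = ∑ n ∈ Finset.range ((b - a).toNat + 1),
        ∑ n' ∈ Finset.range ((hi - lo).toNat + 1),
          ((c n * d n' : ℤ) : K) * weightedEval p (binomialWeight a lo n n') F := by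
      simp only [weightedEval_apply, Finset.mul_sum]
      simp_rw [Finset.sum_comm (t := F.coeff.support)]
      refine Finset.sum_congr rfl fun e _ ↦ ?_
      simp only [hPdef, Finset.sum_mul_sum, Int.cast_sum]
      simp only [Finset.sum_mul, Finset.mul_sum]
      refine Finset.sum_congr rfl fun n _ ↦ Finset.sum_congr rfl fun n' _ ↦ ?_
      simp only [binomialWeight]
      push_cast
      ring
    rw [this]
    refine Finset.sum_eq_zero fun n hn ↦ Finset.sum_eq_zero fun n' hn' ↦ ?_
    rw [Finset.mem_range] at hn hn'
    rw [weightedEval_binomialWeight_eq_zero p a lo m n n' (by omega) F hF, mul_zero]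
  have hv : ∀ e, v (monomialAt p e) = 1 := fun e ↦ by
    simp [monomialAt, map_mul, map_zpow₀, hp₁, hp₂]
  have hPe₀ : P e₀ = 1 := by simp [hPdef, hc _ hab.1 hab.2, hd _ hlh.1 hlh.2]
  have hint : ∀ z : ℤ, v (z : K) ≤ 1 := fun z ↦ intCast_mem v.integer z
  have hne : v (F.coeff e₀) ≠ 0 := (Valuation.ne_zero_iff v).2 (Finsupp.mem_support_iff.1 he₀)
  rw [weightedEval_apply] at hP0
  have := v.map_sum_eq_of_lt he₀ (f := fun e ↦ F.coeff e * ((P e : K) * monomialAt p e)) ?_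
  · rw [hP0, map_zero, map_mul, map_mul, hPe₀, hv] at this
    simp at this
    exact hne (by simpa using this.symm)
  · intro e he
    simp only [Finset.mem_sdiff, Finset.mem_singleton] at he
    simp only [map_mul, hv, hPe₀, Int.cast_one, map_one, mul_one]
    -- A coefficient at least as large as `a_{e₀}` is killed by `P`; a smaller one stays smaller, as
    -- integers have valuation at most 1.
    by_cases hle : v (F.coeff e₀) ≤ v (F.coeff e)
    · have : P e = 0 := by
        have h1 := hcol e he.1 hle
        simp only [hPdef, hc _ h1.1 h1.2]
        split_ifs with h
        · have h2 := hrow e he.1 hle h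
          rw [hd _ h2.1 h2.2, if_neg fun h' ↦ he.2 (Prod.ext h h'), mul_zero]
        · rw [zero_mul]
      simpa [this] using zero_lt_iff.2 hne
    · exact (mul_le_of_le_one_right' (hint _)).trans_lt (not_le.1 hle)

end Functional

/-! ### Chain members as columns of maximal monomials on the line `Y = 0` -/

section Chain

variable {K : Type*} [Field K] {v : Valuation K ℝᵐ⁰} {F : Laurent K}

lemma pt_mem_convexHull {T : Set (ℤ × ℤ)} {e : ℤ × ℤ} (he : e ∈ T) :
    pt e ∈ convexHull ℝ (pt '' T) := subset_convexHull ℝ _ ⟨e, he, rfl⟩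

lemma pt_mem_dualCell {D : Set (ℝ × ℝ)} {e : ℤ × ℤ} (he : ∀ Q ∈ D, e ∈ topSupport v F Q) :
    pt e ∈ dualCell v F D :=
  pt_mem_convexHull he

/-- The exponents defining the dual cell of an edge, for an edge presented by a point `Q`. -/
lemma forall_mem_topSupport_iff {Q : ℝ × ℝ} {e : ℤ × ℤ} :
    (∀ Q' ∈ {Q' | topSupport v F Q ⊆ topSupport v F Q'}, e ∈ topSupport v F Q') ↔
      e ∈ topSupport v F Q :=
  ⟨fun h ↦ h Q (Set.Subset.refl _), fun h _ hQ' ↦ hQ' h⟩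

lemma mem_carrier_bounds {S : VSeg} {w : ℝ × ℝ} (hw : w ∈ S.carrier) :
    w.1 = S.x ∧ (S.lo : ℝ) ≤ w.2 ∧ w.2 ≤ S.hi := by
  obtain ⟨a, b, ha, hb, hab, rfl⟩ := hw
  have hle : (S.lo : ℝ) ≤ S.hi := by exact_mod_cast S.le
  simp only [pt, Prod.smul_mk, smul_eq_mul, Prod.mk_add_mk]
  obtain rfl : a = 1 - b := by linarith
  refine ⟨by ring, by nlinarith, by nlinarith⟩

/-- The lower end of the segment belongs to the set it is cut out of. -/
lemma lo_mem_of_carrier_eq {T : Set (ℤ × ℤ)} {S : VSeg}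
    (h : convexHull ℝ (pt '' T) = S.carrier) : (S.x, S.lo) ∈ T := by
  by_contra hT
  -- By integrality, omitting the lower end would lift the whole hull by at least 1.
  have hsub : convexHull ℝ (pt '' T) ⊆ {w | (S.lo : ℝ) + 1 ≤ w.2} := by
    refine convexHull_min ?_ (convex_halfSpace_ge (f := Prod.snd) ⟨fun _ _ ↦ rfl, fun _ _ ↦ rfl⟩ _)
    rintro _ ⟨e, he, rfl⟩
    obtain ⟨h1, h2, -⟩ := mem_carrier_bounds (h ▸ pt_mem_convexHull he)
    simp only [pt, Int.cast_inj, Int.cast_le] at h1 h2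
    have hne : e.2 ≠ S.lo := fun h3 ↦ hT (by rw [← h1, ← h3]; exact he)
    have : S.lo + 1 ≤ e.2 := by omega
    simp only [Set.mem_ofPred_eq, pt]
    exact_mod_cast this
  have := hsub (h ▸ left_mem_segment ℝ (pt (S.x, S.lo)) (pt (S.x, S.hi)) : pt (S.x, S.lo) ∈ _)
  simp only [Set.mem_ofPred_eq, pt] at this
  linarith

lemma mem_of_unique_min {T : Set (ℤ × ℤ)} {e₀ : ℤ × ℤ} (h : pt e₀ ∈ convexHull ℝ (pt '' T))
    (hmin : ∀ w ∈ convexHull ℝ (pt '' T), w ≠ pt e₀ → (e₀.1 : ℝ) < w.1) : e₀ ∈ T := by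
  by_contra hT
  have hsub : convexHull ℝ (pt '' T) ⊆ {w | (e₀.1 : ℝ) < w.1} := by
    refine convexHull_min ?_ (convex_halfSpace_gt (f := Prod.fst) ⟨fun _ _ ↦ rfl, fun _ _ ↦ rfl⟩ _)
    rintro _ ⟨e, he, rfl⟩
    refine hmin _ (subset_convexHull ℝ _ ⟨e, he, rfl⟩) fun heq ↦ hT ?_
    simp only [pt, Prod.mk.injEq, Int.cast_inj] at heq
    rwa [← Prod.ext heq.1 heq.2]
  exact lt_irrefl (e₀.1 : ℝ) (hsub h)

lemma mem_of_unique_max {T : Set (ℤ × ℤ)} {e₀ : ℤ × ℤ} (h : pt e₀ ∈ convexHull ℝ (pt '' T))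
    (hmax : ∀ w ∈ convexHull ℝ (pt '' T), w ≠ pt e₀ → w.1 < (e₀.1 : ℝ)) : e₀ ∈ T := by
  by_contra hT
  have hsub : convexHull ℝ (pt '' T) ⊆ {w | w.1 < (e₀.1 : ℝ)} := by
    refine convexHull_min ?_ (convex_halfSpace_lt (f := Prod.fst) ⟨fun _ _ ↦ rfl, fun _ _ ↦ rfl⟩ _)
    rintro _ ⟨e, he, rfl⟩
    refine hmax _ (subset_convexHull ℝ _ ⟨e, he, rfl⟩) fun heq ↦ hT ?_
    simp only [pt, Prod.mk.injEq, Int.cast_inj] at heq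
    rwa [← Prod.ext heq.1 heq.2]
  exact lt_irrefl (e₀.1 : ℝ) (hsub h)

/-- A member of the chain of a long edge on the line `Y = 0` is the column `S.x` of the set of
monomials that are maximal at some point `(X, 0)`. -/
lemma exists_topSupport_of_mem_chain {L : Set (ℝ × ℝ)} (hL : ∀ Q ∈ L, Q.2 = 0) {S : VSeg}
    (hS : S ∈ chain v F L) : ∃ X : ℝ, (S.x, S.lo) ∈ topSupport v F (X, 0) ∧
      ∀ e ∈ topSupport v F (X, 0), e.1 = S.x → S.lo ≤ e.2 ∧ e.2 ≤ S.hi := by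
  rcases hS with ⟨E, ⟨Q, -, -, rfl⟩, hEL, hS⟩ | ⟨hlh, A, hA, -, hmem, hmin⟩ |
    ⟨hlh, A, hA, -, hmem, hmax⟩
  · have hQ : Q = (Q.1, 0) := Prod.ext rfl (hL Q (hEL (Set.Subset.refl _)))
    rw [dualCell] at hS
    simp only [forall_mem_topSupport_iff] at hS
    refine ⟨Q.1, hQ ▸ lo_mem_of_carrier_eq hS, fun e he _ ↦ ?_⟩
    rw [← hQ] at he
    obtain ⟨-, h⟩ := mem_carrier_bounds (hS ▸ pt_mem_convexHull he)
    simpa only [pt, Int.cast_le] using h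
  · have hQ : A = (A.1, 0) := Prod.ext rfl (hL A hA)
    have hpt : ∀ e ∈ topSupport v F A, pt e ∈ dualCell v F {A} := fun e he ↦
      pt_mem_dualCell (by rintro _ rfl; exact he)
    have hm : (S.x, S.lo) ∈ topSupport v F A :=
      mem_of_unique_min hmem hmin A rfl
    refine ⟨A.1, hQ ▸ hm, fun e he hx ↦ ?_⟩
    rw [← hQ] at he
    by_cases h : pt e = pt (S.x, S.lo)
    · simp only [pt, Prod.mk.injEq, Int.cast_inj] at h
      omega
    · have := hmin _ (hpt e he) h
      simp [pt, hx] at this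
  · have hQ : A = (A.1, 0) := Prod.ext rfl (hL A hA)
    have hpt : ∀ e ∈ topSupport v F A, pt e ∈ dualCell v F {A} := fun e he ↦
      pt_mem_dualCell (by rintro _ rfl; exact he)
    have hm : (S.x, S.lo) ∈ topSupport v F A :=
      mem_of_unique_max hmem hmax A rfl
    refine ⟨A.1, hQ ▸ hm, fun e he hx ↦ ?_⟩
    rw [← hQ] at he
    by_cases h : pt e = pt (S.x, S.lo)
    · simp only [pt, Prod.mk.injEq, Int.cast_inj] at h
      omega
    · have := hmax _ (hpt e he) h
      simp [pt, hx] at this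

/-- A horizontal edge contains two points. -/
lemma exists_shift_mem_edge {Q : ℝ × ℝ} {x : ℤ} (hx : ∀ e ∈ topSupport v F Q, e.1 = x) :
    ∃ ε : ℝ, ε ≠ 0 ∧ topSupport v F Q ⊆ topSupport v F (Q + (ε, 0)) := by
  have hcont : ∀ e, Continuous fun ε : ℝ ↦ tropTerm v F e (Q + (ε, 0)) := fun e ↦ by
    simp only [tropTerm, Prod.fst_add, Prod.snd_add]
    fun_prop
  have hev : ∀ᶠ ε in nhds (0 : ℝ), ∀ e' ∈ F.coeff.support, ∀ e ∈ F.coeff.support,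
      tropTerm v F e' Q < tropTerm v F e Q →
        tropTerm v F e' (Q + (ε, 0)) < tropTerm v F e (Q + (ε, 0)) := by
    simp only [Filter.eventually_all_finset]
    intro e' _ e _
    by_cases h : tropTerm v F e' Q < tropTerm v F e Q
    · filter_upwards [(hcont e').tendsto 0 |>.eventually_lt ((hcont e).tendsto 0)
        (by simpa [← Prod.zero_eq_mk] using h)] with ε hε _ using hε
    · exact Filter.Eventually.of_forall fun _ h' ↦ absurd h' h
  obtain ⟨ε, hε, hne⟩ := ((hev.filter_mono nhdsWithin_le_nhds).and
    (self_mem_nhdsWithin (s := {0}ᶜ))).exists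
  refine ⟨ε, hne, fun e he ↦ ⟨he.1, fun e' he' ↦ ?_⟩⟩
  -- Strict inequalities survive a small shift; monomials tied at `Q` share the exponent `x` and
  -- change by the same amount.
  rcases (he.2 e' he').lt_or_eq with h | h
  · exact (hε e' he' e he.1 h).le
  · have hetop : e' ∈ topSupport v F Q := ⟨he', fun e'' he'' ↦ (he.2 e'' he'').trans h.ge⟩
    have h1 := hx e he
    have h2 := hx e' hetop
    simp only [tropTerm, Prod.fst_add, Prod.snd_add, h1, h2] at h ⊢
    linarith

lemma snd_eq_zero_of_collinear {L : Set (ℝ × ℝ)} (hL : Collinear ℝ L) {Q : ℝ × ℝ} {ε : ℝ}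
    (hε : ε ≠ 0) (hQ : Q ∈ L) (hQ' : Q + (ε, 0) ∈ L) (h0 : Q.2 = 0) : ∀ R ∈ L, R.2 = 0 := by
  obtain ⟨u, hu⟩ := (collinear_iff_of_mem hQ).1 hL
  obtain ⟨r, hr⟩ := hu _ hQ'
  have h1 := congrArg Prod.fst hr
  have h2 := congrArg Prod.snd hr
  simp only [Prod.fst_add, Prod.snd_add, vadd_eq_add, Prod.smul_fst, Prod.smul_snd,
    smul_eq_mul, h0, add_zero] at h1 h2
  have hr0 : r ≠ 0 := by rintro rfl; apply hε; linarith
  have hu2 : u.2 = 0 := (mul_eq_zero.1 h2.symm).resolve_left hr0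
  intro R hR
  obtain ⟨s, rfl⟩ := hu R hR
  simp [hu2, h0]

/-- A long edge containing a horizontal edge with vertical dual lies on the line `Y = 0`. -/
lemma snd_eq_zero_of_isLongEdge {L E : Set (ℝ × ℝ)} {D : VSeg} (hL : IsLongEdge v F L)
    (hE : IsEdge v F E) (hhor : ∀ Q ∈ E, Q.2 = 0) (hEL : E ⊆ L)
    (hD : dualCell v F E = D.carrier) : ∀ Q ∈ L, Q.2 = 0 := by
  obtain ⟨𝓔, -, -, -, hcol, -, rfl⟩ := hL
  obtain ⟨Q, -, -, rfl⟩ := hE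
  have hx : ∀ e ∈ topSupport v F Q, e.1 = D.x := fun e he ↦ by
    have := (mem_carrier_bounds (hD ▸ pt_mem_dualCell (forall_mem_topSupport_iff.2 he))).1
    simpa [pt] using this
  obtain ⟨ε, hε, hsub⟩ := exists_shift_mem_edge hx
  exact snd_eq_zero_of_collinear hcol hε (hEL (Set.Subset.refl _)) (hEL hsub)
    (hhor _ (Set.Subset.refl _))

end Chain

/-! ### The extended Newton polyhedron and chords of `g` -/

section Chord

variable {K : Type*} [Field K] {v : Valuation K ℝᵐ⁰} {F : Laurent K}

lemma mem_extNewton {e : ℤ × ℤ} (he : e ∈ F.coeff.support) {z : ℝ} (hz : z ≤ coeffVal v F e) :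
    ((e.1 : ℝ), (e.2 : ℝ), z) ∈ extNewton v F :=
  subset_convexHull ℝ _ ⟨e, he, rfl, rfl, hz⟩

/-- A linear inequality between `x` and `z` valid at the generators holds on the polyhedron. -/
lemma add_le_of_mem_extNewton {X c : ℝ}
    (h : ∀ e ∈ F.coeff.support, (e.1 : ℝ) * X + coeffVal v F e ≤ c)
    {w : ℝ × ℝ × ℝ} (hw : w ∈ extNewton v F) : w.1 * X + w.2.2 ≤ c := by
  refine convexHull_min (t := {w : ℝ × ℝ × ℝ | w.1 * X + w.2.2 ≤ c}) ?_
    (convex_halfSpace_le (f := fun w : ℝ × ℝ × ℝ ↦ w.1 * X + w.2.2) ⟨?_, ?_⟩ c) hw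
  · rintro w ⟨e, he, h1, -, h2⟩
    simp only [Set.mem_ofPred_eq, h1]
    linarith [h e he]
  · intro x y
    simp only [Prod.fst_add, Prod.snd_add]
    ring
  · intro r x
    simp only [Prod.smul_fst, Prod.smul_snd, smul_eq_mul]
    ring

lemma g_le {X c x : ℝ} (h : ∀ e ∈ F.coeff.support, (e.1 : ℝ) * X + coeffVal v F e ≤ c)
    (hx : x ∈ gDomain v F) : x * X + g v F x ≤ c := by
  obtain ⟨y, z, hz⟩ := hx
  have : g v F x ≤ c - x * X := by
    refine csSup_le ⟨z, y, hz⟩ ?_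
    rintro z ⟨y, hz⟩
    linarith [add_le_of_mem_extNewton h hz]
  linarith

/-- Ensures that the supremum defining `g` bounds its fiber from above instead of taking a default
value. -/
lemma bddAbove_extNewton_fiber (x : ℝ) : BddAbove {z | ∃ y : ℝ, (x, y, z) ∈ extNewton v F} := by
  obtain ⟨c, hc⟩ := (F.coeff.support.image (coeffVal v F)).bddAbove
  refine ⟨c, ?_⟩
  rintro z ⟨y, hz⟩
  have := add_le_of_mem_extNewton (X := 0) (c := c) (fun e he ↦ ?_) hz
  · simpa using this
  · simpa using hc (Finset.mem_coe.2 (Finset.mem_image_of_mem _ he))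

lemma isBounded_gDomain : Bornology.IsBounded (gDomain v F) := by
  set s : Finset ℝ := F.coeff.support.image fun e ↦ (e.1 : ℝ)
  have hs : Bornology.IsBounded (convexHull ℝ (s : Set ℝ)) :=
    isBounded_convexHull.2 s.finite_toSet.isBounded
  refine hs.subset ?_
  rintro x ⟨y, z, hz⟩
  refine convexHull_min (t := Prod.fst ⁻¹' convexHull ℝ (s : Set ℝ)) ?_
    ((convex_convexHull ℝ _).linear_preimage (LinearMap.fst ℝ ℝ (ℝ × ℝ))) hz
  rintro w ⟨e, he, h1, -⟩
  exact subset_convexHull ℝ _ (by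
    rw [h1]; exact Finset.mem_coe.2 (Finset.mem_image_of_mem _ he))

/-- Two exponents whose coefficients have valuation at least `g x` are, horizontally, at most
`gHat x` apart. -/
lemma sub_le_gHat {x : ℝ} {e e' : ℤ × ℤ} (he : e ∈ F.coeff.support) (he' : e' ∈ F.coeff.support)
    (h : g v F x ≤ coeffVal v F e) (h' : g v F x ≤ coeffVal v F e') (hle : e.1 ≤ e'.1) :
    (e'.1 : ℝ) - e.1 ≤ gHat v F x := by
  have hsub : Set.Icc (e.1 : ℝ) e'.1 ⊆ {t | t ∈ gDomain v F ∧ g v F x ≤ g v F t} := by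
    rw [← segment_eq_Icc (by exact_mod_cast hle)]
    rintro _ ⟨a, b, ha, hb, hab, rfl⟩
    -- Generators extend downwards, so both exponents may be taken at height `g x`; the chord
    -- joining them stays in the polyhedron.
    have hm : a • ((e.1 : ℝ), (e.2 : ℝ), g v F x) + b • ((e'.1 : ℝ), (e'.2 : ℝ), g v F x) ∈
        extNewton v F :=
      convex_convexHull ℝ _ (mem_extNewton he h) (mem_extNewton he' h') ha hb hab
    simp only [Prod.smul_mk, Prod.mk_add_mk, ← add_smul, hab, one_smul] at hm
    exact ⟨⟨_, _, hm⟩, le_csSup (bddAbove_extNewton_fiber _) ⟨_, hm⟩⟩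
  -- An infinite volume would have real value 0, so monotonicity requires finiteness.
  have hfin : MeasureTheory.volume {t | t ∈ gDomain v F ∧ g v F x ≤ g v F t} ≠ ⊤ :=
    (isBounded_gDomain.subset fun t ht ↦ ht.1).measure_lt_top.ne
  have := MeasureTheory.measureReal_mono hsub hfin
  rwa [Real.volume_real_Icc_of_le (by exact_mod_cast hle)] at this

end Chord

/-! ### Horizontal spread of the large coefficients -/

section Main

variable {K : Type*} [Field K] {v : Valuation K ℝᵐ⁰} {F : Laurent K}

lemma valuation_eq_one_of_log_eq_zero {u : Kˣ} (h : WithZero.log (v (u : K)) = 0) :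
    v (u : K) = 1 := by
  rw [← WithZero.exp_log ((Valuation.ne_zero_iff v).2 u.ne_zero), h, WithZero.exp_zero]

lemma valuation_le_iff_coeffVal_le {e e' : ℤ × ℤ} (he : e ∈ F.coeff.support)
    (he' : e' ∈ F.coeff.support) :
    v (F.coeff e) ≤ v (F.coeff e') ↔ coeffVal v F e ≤ coeffVal v F e' :=
  (WithZero.log_le_log ((Valuation.ne_zero_iff v).2 (Finsupp.mem_support_iff.1 he))
    ((Valuation.ne_zero_iff v).2 (Finsupp.mem_support_iff.1 he'))).symm

/-- Comparison at `(X, 0)` with a monomial that is maximal there. -/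
lemma mul_add_coeffVal_le {X : ℝ} {e₀ : ℤ × ℤ} (h : e₀ ∈ topSupport v F (X, 0)) {e : ℤ × ℤ}
    (he : e ∈ F.coeff.support) :
    (e.1 : ℝ) * X + coeffVal v F e ≤ e₀.1 * X + coeffVal v F e₀ := by
  simpa [tropTerm] using h.2 e he

/-- In the column of a monomial maximal at `(X, 0)`, a coefficient of at least the same valuation
is maximal there, too. -/
lemma mem_topSupport_of_le {X : ℝ} {e₀ : ℤ × ℤ} (h : e₀ ∈ topSupport v F (X, 0)) {e : ℤ × ℤ}
    (he : e ∈ F.coeff.support) (hx : e.1 = e₀.1) (hle : coeffVal v F e₀ ≤ coeffVal v F e) :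
    e ∈ topSupport v F (X, 0) := by
  refine ⟨he, fun e' he' ↦ (h.2 e' he').trans ?_⟩
  simpa [tropTerm, hx] using hle

/-- The multiplicity is at most the length of a member of the chain plus the horizontal width of
the coefficients of at least its valuation. -/
lemma multiplicity_le_length_add {p : Kˣ × Kˣ} {m : ℕ} (hF : F ∈ pointIdeal p ^ m)
    (hP : valPoint v p = (0, 0)) {L : Set (ℝ × ℝ)} (hL : ∀ Q ∈ L, Q.2 = 0) {S : VSeg}
    (hS : S ∈ chain v F L) {a b : ℤ}
    (hcol : ∀ e ∈ F.coeff.support, segVal v F S ≤ coeffVal v F e → a ≤ e.1 ∧ e.1 ≤ b) :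
    (m : ℤ) ≤ S.length + (b - a) := by
  obtain ⟨X, hX, hX'⟩ := exists_topSupport_of_mem_chain hL hS
  rw [add_comm]
  refine multiplicity_le_add v hF (valuation_eq_one_of_log_eq_zero (congrArg Prod.fst hP))
    (valuation_eq_one_of_log_eq_zero (congrArg Prod.snd hP)) hX.1
    (fun e he hle ↦ hcol e he ((valuation_le_iff_coeffVal_le hX.1 he).1 hle)) ?_
  exact fun e he hle hx ↦ hX' e (mem_topSupport_of_le hX he hx
    ((valuation_le_iff_coeffVal_le hX.1 he).1 hle)) hx

/-- A monomial maximal at `(X, 0)` gives a line of slope `-X` that lies above the graph of `g` and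
has height `segVal` at `S.x`. -/
lemma g_le_segVal {L : Set (ℝ × ℝ)} (hL : ∀ Q ∈ L, Q.2 = 0) {S : VSeg} (hS : S ∈ chain v F L) :
    g v F S.x ≤ segVal v F S := by
  obtain ⟨X, hX, -⟩ := exists_topSupport_of_mem_chain hL hS
  have := g_le (fun e he ↦ mul_add_coeffVal_le hX he) ⟨_, _, mem_extNewton hX.1 le_rfl⟩
  simpa [segVal] using this

lemma multiplicity_sub_gHat_le {p : Kˣ × Kˣ} {m : ℕ} (hF : F ∈ pointIdeal p ^ m)
    (hP : valPoint v p = (0, 0)) {L : Set (ℝ × ℝ)} (hL : ∀ Q ∈ L, Q.2 = 0) {S : VSeg}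
    (hS : S ∈ chain v F L) : (m : ℝ) - gHat v F S.x ≤ S.length := by
  obtain ⟨X, hX, -⟩ := exists_topSupport_of_mem_chain hL hS
  -- The extreme columns of `T` serve as `a` and `b`; their distance is at most a chord of `g`.
  set T := F.coeff.support.filter fun e ↦ segVal v F S ≤ coeffVal v F e
  have hT : T.Nonempty := ⟨_, Finset.mem_filter.2 ⟨hX.1, le_rfl⟩⟩
  obtain ⟨e, he, hmin⟩ := T.exists_min_image Prod.fst hT
  obtain ⟨e', he', hmax⟩ := T.exists_max_image Prod.fst hT
  have hm := multiplicity_le_length_add hF hP hL hS (a := e.1) (b := e'.1) fun e₁ h1 h2 ↦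
    ⟨hmin _ (Finset.mem_filter.2 ⟨h1, h2⟩), hmax _ (Finset.mem_filter.2 ⟨h1, h2⟩)⟩
  have hle := hmin e' he'
  rw [Finset.mem_filter] at he he'
  have hg := g_le_segVal hL hS
  have := sub_le_gHat he.1 he'.1 (hg.trans he.2) (hg.trans he'.2) hle
  have hm' : (m : ℝ) ≤ S.length + (e'.1 - e.1) := by exact_mod_cast hm
  linarith

/-- If `R.x` lies to the right of `S.x` and carries a larger valuation, then to the left of `S.x`
all valuations are smaller than the one of `S`. -/
lemma le_fst_of_segVal_lt {L : Set (ℝ × ℝ)} (hL : ∀ Q ∈ L, Q.2 = 0) {R S : VSeg}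
    (hS : S ∈ chain v F L) (hR : R ∈ chain v F L) (hx : S.x < R.x)
    (hval : segVal v F S < segVal v F R) {e : ℤ × ℤ} (he : e ∈ F.coeff.support)
    (hle : segVal v F S ≤ coeffVal v F e) : S.x ≤ e.1 := by
  by_contra! hlt
  obtain ⟨X, hX, -⟩ := exists_topSupport_of_mem_chain hL hS
  obtain ⟨Y, hY, -⟩ := exists_topSupport_of_mem_chain hL hR
  have h1 := mul_add_coeffVal_le hX he
  have h2 := mul_add_coeffVal_le hX hY.1
  simp only [segVal] at hval hle
  have hx' : (S.x : ℝ) < R.x := by exact_mod_cast hx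
  have hlt' : (e.1 : ℝ) < S.x := by exact_mod_cast hlt
  -- Comparison with `e` on the left forces `X ≥ 0`, comparison with `R` on the right forces `X <
  -- 0`.
  nlinarith

/-- The mirror image of `le_fst_of_segVal_lt`. -/
lemma fst_le_of_segVal_lt {L : Set (ℝ × ℝ)} (hL : ∀ Q ∈ L, Q.2 = 0) {R S : VSeg}
    (hS : S ∈ chain v F L) (hR : R ∈ chain v F L) (hx : R.x < S.x)
    (hval : segVal v F S < segVal v F R) {e : ℤ × ℤ} (he : e ∈ F.coeff.support)
    (hle : segVal v F S ≤ coeffVal v F e) : e.1 ≤ S.x := by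
  by_contra! hlt
  obtain ⟨X, hX, -⟩ := exists_topSupport_of_mem_chain hL hS
  obtain ⟨Y, hY, -⟩ := exists_topSupport_of_mem_chain hL hR
  have h1 := mul_add_coeffVal_le hX he
  have h2 := mul_add_coeffVal_le hX hY.1
  simp only [segVal] at hval hle
  have hx' : (R.x : ℝ) < S.x := by exact_mod_cast hx
  have hlt' : (S.x : ℝ) < e.1 := by exact_mod_cast hlt
  nlinarith

end Main

end TropMult

end

theorem mainTheorem8 {K : Type*} [Field K] (v : Valuation K ℝᵐ⁰) (F : TropMult.Laurent K)
    (m : ℕ) (p : Kˣ × Kˣ) (hF : TropMult.HasMultiplicity F p m)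
    -- `P = Val(p)` is the origin, lies on the horizontal edge `E` and is not a vertex
    (hP : TropMult.valPoint v p = (0, 0))
    (E : Set (ℝ × ℝ)) (hE : TropMult.IsEdge v F E) (hPE : TropMult.valPoint v p ∈ E)
    (hPv : ¬ TropMult.IsVertex v F (TropMult.valPoint v p)) (hhor : ∀ Q ∈ E, Q.2 = 0)
    -- `L` is the maximal long edge containing `E`
    (L : Set (ℝ × ℝ)) (hL : Maximal (TropMult.IsLongEdge v F) L) (hEL : E ⊆ L)
    -- `D` is the vertical edge `d(E)`
    (D : TropMult.VSeg) (hD : TropMult.dualCell v F E = D.carrier) :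
    -- `m_i ≥ m - ĝ(x_i)` for every `i`
    (∀ S ∈ TropMult.chain v F L, (m : ℝ) - TropMult.gHat v F (S.x : ℝ) ≤ (S.length : ℝ)) ∧
    -- `q < l ≤ r` and `val_r > val_q ≥ val_{r+1}` imply `m_q + (x_{r+1} - x_q) ≥ m`
    (∀ S ∈ TropMult.chain v F L, S.x < D.x →
      ∀ R R' : TropMult.VSeg, TropMult.Consecutive v F L R R' → D.x ≤ R.x →
        TropMult.segVal v F S < TropMult.segVal v F R →
        TropMult.segVal v F R' ≤ TropMult.segVal v F S →
        (m : ℤ) ≤ S.length + (R'.x - S.x)) ∧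
    -- the symmetric statement for `q > l`
    (∀ S ∈ TropMult.chain v F L, D.x < S.x →
      ∀ R' R : TropMult.VSeg, TropMult.Consecutive v F L R' R → R.x ≤ D.x →
        TropMult.segVal v F S < TropMult.segVal v F R →
        TropMult.segVal v F R' ≤ TropMult.segVal v F S →
        (m : ℤ) ≤ S.length + (S.x - R'.x)) := by
  have h0 := TropMult.snd_eq_zero_of_isLongEdge hL.1 hE hhor hEL hD
  refine ⟨fun S hS ↦ TropMult.multiplicity_sub_gHat_le hF.1 hP h0 hS, ?_, ?_⟩
  · rintro S hS hSD R R' ⟨hR, hR', hRR', -⟩ hDR hSR hR'S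
    -- The larger value at `R` bounds the columns on the left by `S.x`, and on the right by `R'.x`,
    -- since values at least that of `S` are at least that of `R'`.
    exact TropMult.multiplicity_le_length_add hF.1 hP h0 hS fun e he hle ↦
      ⟨TropMult.le_fst_of_segVal_lt h0 hS hR (hSD.trans_le hDR) hSR he hle,
        TropMult.fst_le_of_segVal_lt h0 hR' hR hRR' (hR'S.trans_lt hSR) he (hR'S.trans hle)⟩
  · rintro S hS hDS R' R ⟨hR', hR, hRR', -⟩ hRD hSR hR'S
    exact TropMult.multiplicity_le_length_add hF.1 hP h0 hS fun e he hle ↦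
      ⟨TropMult.le_fst_of_segVal_lt h0 hR' hR hRR' (hR'S.trans_lt hSR) he (hR'S.trans hle),
        TropMult.fst_le_of_segVal_lt h0 hS hR (hRD.trans_lt hDS) hSR he hle⟩
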